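/- Let $\mathcal M$ be a complete and cocomplete category with a model structure $(\mathrm{Cof},\mathrm{Fib},\mathcal W)$ such that the weak factorization system $(\mathrm{Cof}\cap\mathcal W,\mathrm{Fib})$ is cofibrantly generated, and let $(\mathcal L,\mathcal R)$ be a cofibrantly generated weak factorization system on $\mathcal M$ with $\mathrm{Cof}\cap\mathcal W\subset\mathcal L\subset\mathrm{Cof}$. (A weak factorization system $(\mathcal A,\mathcal B)$ is cofibrantly generated if there is a set $K$ of morphisms permitting the small object argument such that $\mathcal B$ is the class of morphisms with the right lifting property with respect to $K$, and $\mathcal A$ the class of morphisms with the left lifting property with respect to $\mathcal B$.) Fix a functorial factorization $f=\beta(f)\circ\alpha(f)$ with $\alpha(f)\in\mathcal L$ and $\beta(f)\in\mathcal R$ (for example the one given by the small object argument), and a functorial factorization of morphisms into a cofibration followed by a trivial fibration. Use the following notation. - $Q:\mathcal M\to\mathcal M_{cof}$ is the resulting cofibrant replacement functor, where $\mathcal M_{cof}$ is the full subcategory of cofibrant objects: $\varnothing\to Q(X)\to X$ is the factorization of $\varnothing\to X$ into a cofibration and a trivial fibration. - An object $X$ is fibrant with respect to $\mathcal L$ if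 $X\to\mathbf 1$ belongs to $\mathcal R$; $\mathcal M_{cof}^{f,\mathcal L}$ is the full subcategory of $\mathcal M_{cof}$ of such objects. $R_{\mathcal L}:\mathcal M_{cof}\to\mathcal M_{cof}^{f,\mathcal L}$ is the functor sending $X$ to the middle object of the factorization $\beta\circ\alpha$ of $X\to\mathbf 1$. - $\mathrm{Path}_{\mathcal L}(Y)$ is the middle object of the factorization $\beta\circ\alpha$ of the diagonal $Y\to Y\times Y$. For $f,g:X\to Y$, write $f\sim^r_{\mathcal L}g$ if $(f,g):X\to Y\times Y$ factors through $\beta(\mathrm{id}_Y,\mathrm{id}_Y):\mathrm{Path}_{\mathcal L}(Y)\to Y\times Y$, and let $\sim_{\mathcal L}$ be the transitive closure of $\sim^r_{\mathcal L}$ (it is a congruence). - $\mathcal W_{\mathcal L}$ is the class of morphisms $f:X\to Y$ of $\mathcal M$ such that for every $Z\in\mathcal M_{cof}^{f,\mathcal L}$ the map $\mathcal M(R_{\mathcal L}(Q(Y)),Z)/{\sim_{\mathcal L}}\to\mathcal M(R_{\mathcal L}(Q(X)),Z)/{\sim_{\mathcal L}}$ induced by $R_{\mathcal L}(Q(f))$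 is bijective. - $\mathcal C[\Sigma^{-1}]$ is the categorical localization of $\mathcal C$ at a class $\Sigma$ of morphisms. Then the inclusion functors $\mathcal M_{cof}^{f,\mathcal L}\subset\mathcal M_{cof}\subset\mathcal M$ induce (by the universal properties of the quotient and of the localization) equivalences of categories $$\mathcal M_{cof}^{f,\mathcal L}/{\sim_{\mathcal L}}\;\simeq\;\mathcal M_{cof}[(\mathcal W\cup\mathcal L)^{-1}]\;\simeq\;\mathcal M[\mathcal W_{\mathcal L}^{-1}].$$ The functor $R_{\mathcal L}\circ Q:\mathcal M\to\mathcal M_{cof}^{f,\mathcal L}$ induces a functor $\mathcal M[\mathcal W_{\mathcal L}^{-1}]\to\mathcal M_{cof}^{f,\mathcal L}/{\sim_{\mathcal L}}$, which is an equivalence quasi-inverse to the composite of these two equivalences. Moreover, the localization functor $\mathcal M\to\mathcal M[\mathcal W_{\mathcal L}^{-1}]$ factors uniquely as a composite $\mathcal M\to\mathcal M[\mathcal W^{-1}]\to\mathcal M[\mathcal W_{\mathcal L}^{-1}]$ of the localization functor to $\mathrm{Ho}(\mathcal M)=\mathcal M[\mathcal W^{-1}]$ with a functor. -/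

import Mathlib

open CategoryTheory Limits HomotopicalAlgebra

universe v u

namespace WFSLocalization

section WeakFactorizationSystems

variable {M : Type u} [Category.{v} M]

/-- A weak factorization system `(L, R)` is cofibrantly generated if there is a (small) set `K`
of morphisms which permits the small object argument, such that `R` is the class `inj(K)` of
morphisms having the right lifting property with respect to `K`, and `L` is the class `cof(K)`
of morphisms having the left lifting property with respect to `inj(K)`. -/
structure IsCofibrantlyGeneratedWFS (L R : MorphismProperty M) : Prop where
  isWeakFactorizationSystem : MorphismProperty.IsWeakFactorizationSystem L R
  exists_generating_set : ∃ K : MorphismProperty M,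
    MorphismProperty.HasSmallObjectArgument.{v} K ∧ L = K.rlp.llp ∧ R = K.rlp

variable {L R : MorphismProperty M} (φ : MorphismProperty.FunctorialFactorizationData L R)

section PathObject

variable [HasBinaryProducts M]

/-- The path object `Path_L(X)`: the middle object in the functorial factorization of the
diagonal `X ⟶ X ⨯ X`. -/
noncomputable def pathObj (X : M) : M := (φ.factorizationData (diag X)).Z

/-- The morphism `α(id_X, id_X) : X ⟶ Path_L(X)`, which belongs to `L`. -/
noncomputable def pathObjι (X : M) : X ⟶ pathObj φ X := (φ.factorizationData (diag X)).i

/-- The morphism `β(id_X, id_X) : Path_L(X) ⟶ X ⨯ X`, which belongs to `R`. -/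
noncomputable def pathObjπ (X : M) : pathObj φ X ⟶ X ⨯ X := (φ.factorizationData (diag X)).p

/-- `f` and `g` are right homotopic with respect to `L`, through the path object `Path_L(Y)`. -/
def RightHomotopic : HomRel M := fun X Y f g =>
  ∃ H : X ⟶ pathObj φ Y, H ≫ pathObjπ φ Y = prod.lift f g

/-- The relation `∼_L`: the transitive closure of right homotopy with respect to `L`. -/
def Homotopic : HomRel M := fun _ _ f g => Relation.TransGen (fun a b => RightHomotopic φ a b) f g

theorem RightHomotopic.precomp {X' X Y : M} (w : X' ⟶ X) {f g : X ⟶ Y}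
    (h : RightHomotopic φ f g) : RightHomotopic φ (w ≫ f) (w ≫ g) := by
  obtain ⟨H, hH⟩ := h
  exact ⟨w ≫ H, by rw [Category.assoc, hH, prod.comp_lift]⟩

theorem RightHomotopic.postcomp {X Y Y' : M} (w : Y ⟶ Y') {f g : X ⟶ Y}
    (h : RightHomotopic φ f g) : RightHomotopic φ (f ≫ w) (g ≫ w) := by
  obtain ⟨H, hH⟩ := h
  let τ : Arrow.mk (diag Y) ⟶ Arrow.mk (diag Y') := Arrow.homMk w (prod.map w w) (by simp)
  obtain ⟨m, hm⟩ : ∃ m : pathObj φ Y ⟶ pathObj φ Y',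
      m ≫ pathObjπ φ Y' = pathObjπ φ Y ≫ prod.map w w := ⟨φ.mapZ τ, φ.mapZ_p τ⟩
  refine ⟨H ≫ m, ?_⟩
  rw [Category.assoc, hm, ← Category.assoc, hH, prod.lift_map]

theorem RightHomotopic.refl {X Y : M} (f : X ⟶ Y) : RightHomotopic φ f f := by
  refine ⟨f ≫ pathObjι φ Y, ?_⟩
  have e : pathObjι φ Y ≫ pathObjπ φ Y = diag Y := (φ.factorizationData (diag Y)).fac
  rw [Category.assoc, e, prod.comp_diag]

theorem RightHomotopic.symm [MorphismProperty.IsWeakFactorizationSystem L R]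
    {X Y : M} {f g : X ⟶ Y} (h : RightHomotopic φ f g) : RightHomotopic φ g f := by
  obtain ⟨H, hH⟩ := h
  have e : pathObjι φ Y ≫ pathObjπ φ Y = diag Y := (φ.factorizationData (diag Y)).fac
  have sq : CommSq (pathObjι φ Y) (pathObjι φ Y) (pathObjπ φ Y)
      (pathObjπ φ Y ≫ prod.lift prod.snd prod.fst) :=
    ⟨by rw [← Category.assoc, e, prod.comp_lift, prod.lift_fst, prod.lift_snd]⟩
  have : HasLiftingProperty (pathObjι φ Y) (pathObjπ φ Y) :=
    MorphismProperty.hasLiftingProperty_of_wfs (W₁ := L) (W₂ := R) _ _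
      (φ.factorizationData (diag Y)).hi (φ.factorizationData (diag Y)).hp
  refine ⟨H ≫ sq.lift, ?_⟩
  rw [Category.assoc, sq.fac_right, ← Category.assoc, hH, prod.comp_lift,
    prod.lift_fst, prod.lift_snd]

theorem Homotopic.precomp {X' X Y : M} (w : X' ⟶ X) {f g : X ⟶ Y}
    (h : Homotopic φ f g) : Homotopic φ (w ≫ f) (w ≫ g) :=
  Relation.TransGen.lift (fun k => w ≫ k) (fun _ _ hk => RightHomotopic.precomp φ w hk) _ _ h

theorem Homotopic.postcomp {X Y Y' : M} (w : Y ⟶ Y') {f g : X ⟶ Y}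
    (h : Homotopic φ f g) : Homotopic φ (f ≫ w) (g ≫ w) :=
  Relation.TransGen.lift (fun k => k ≫ w) (fun _ _ hk => RightHomotopic.postcomp φ w hk) _ _ h

/-- `∼_L` is a congruence on `M`. -/
instance congruence_homotopic [MorphismProperty.IsWeakFactorizationSystem L R] :
    Congruence (Homotopic φ) where
  comp_left w _ _ h := Homotopic.precomp φ w h
  comp_right w h := Homotopic.postcomp φ w h
  equivalence :=
    { refl f := Relation.TransGen.single (RightHomotopic.refl φ f)
      symm h := Relation.transGen_swap.1
        (Relation.TransGen.mono (fun _ _ hk => RightHomotopic.symm φ hk) _ _ h)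
      trans h₁ h₂ := Relation.TransGen.trans h₁ h₂ }

/-- The restriction of `∼_L` to a full subcategory of `M`. -/
def HomotopicOn (P : ObjectProperty M) : HomRel P.FullSubcategory := fun _ _ f g =>
  Homotopic φ f.hom g.hom

/-- The restriction of `∼_L` to a full subcategory of `M` is a congruence, so that the morphisms
of the quotient category are exactly the `∼_L`-equivalence classes of morphisms. -/
instance congruence_homotopicOn [MorphismProperty.IsWeakFactorizationSystem L R]
    (P : ObjectProperty M) : Congruence (HomotopicOn φ P) where
  comp_left w _ _ h := Homotopic.precomp φ w.hom h
  comp_right w h := Homotopic.postcomp φ w.hom h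
  equivalence :=
    { refl f := (congruence_homotopic φ).equivalence.refl f.hom
      symm h := (congruence_homotopic φ).equivalence.symm h
      trans h₁ h₂ := (congruence_homotopic φ).equivalence.trans h₁ h₂ }

/-- The set `M(X, Z)/∼_L`. -/
def HomotopyClasses (X Z : M) : Type v := Quot (fun f g : X ⟶ Z => Homotopic φ f g)

/-- The map `M(Y, Z)/∼_L → M(X, Z)/∼_L` given by precomposition with `w : X ⟶ Y`. -/
def HomotopyClasses.precomp {X Y : M} (w : X ⟶ Y) (Z : M) :
    HomotopyClasses φ Y Z → HomotopyClasses φ X Z :=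
  Quot.map (fun k => w ≫ k) (fun _ _ h => Homotopic.precomp φ w h)

end PathObject

section FibrantReplacement

variable [HasTerminal M]

/-- The objects which are fibrant with respect to `L`: the morphism to the terminal object
belongs to `R`. -/
def lFibrantObjects (R : MorphismProperty M) : ObjectProperty M := fun X => R (terminal.from X)

/-- The fibrant replacement with respect to `L`: the middle object in the functorial
factorization of the morphism to the terminal object. -/
noncomputable def fibrantReplacement : M ⥤ M where
  obj X := (φ.factorizationData (terminal.from X)).Z
  map {X Y} f := φ.mapZ (Arrow.homMk f (𝟙 _) (by simp) :
    Arrow.mk (terminal.from X) ⟶ Arrow.mk (terminal.from Y))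
  map_id X := φ.mapZ_id (terminal.from X)
  map_comp f g := by
    rw [← φ.mapZ_comp]
    congr 1
    ext <;> simp

theorem lFibrantObjects_fibrantReplacement (X : M) :
    lFibrantObjects R ((fibrantReplacement φ).obj X) := by
  have h : R (φ.factorizationData (terminal.from X)).p :=
    (φ.factorizationData (terminal.from X)).hp
  have e : terminal.from ((fibrantReplacement φ).obj X) =
      (φ.factorizationData (terminal.from X)).p := Subsingleton.elim _ _
  rw [lFibrantObjects, e]
  exact h

end FibrantReplacement

end WeakFactorizationSystems

section ModelCategories

variable {M : Type u} [Category.{v} M] [ModelCategory M]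

/-- The cofibrant replacement: the middle object in the functorial factorization of the morphism
from the initial object into a cofibration followed by a trivial fibration. -/
noncomputable def cofibrantReplacement (ψ : MorphismProperty.FunctorialFactorizationData
    (cofibrations M) (trivialFibrations M)) : M ⥤ M where
  obj X := (ψ.factorizationData (initial.to X)).Z
  map {X Y} f := ψ.mapZ (Arrow.homMk (𝟙 _) f (by simp) :
    Arrow.mk (initial.to X) ⟶ Arrow.mk (initial.to Y))
  map_id X := ψ.mapZ_id (initial.to X)
  map_comp f g := by
    rw [← ψ.mapZ_comp]
    congr 1
    ext <;> simp

/-- The cofibrant replacement functor `Q : M ⥤ M_cof`. -/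
noncomputable def functorQ (ψ : MorphismProperty.FunctorialFactorizationData
    (cofibrations M) (trivialFibrations M)) : M ⥤ CofibrantObject M :=
  (cofibrantObjects M).lift (cofibrantReplacement ψ) (fun X => by
    have h : cofibrations M (ψ.factorizationData (initial.to X)).i :=
      (ψ.factorizationData (initial.to X)).hi
    have e : initial.to ((cofibrantReplacement ψ).obj X) =
        (ψ.factorizationData (initial.to X)).i := Subsingleton.elim _ _
    change Cofibration _
    rw [cofibration_iff, e]
    exact h)

/-- The cofibrant objects which are fibrant with respect to `L`. -/
def cofibrantLFibrantObjects (R : MorphismProperty M) : ObjectProperty M :=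
  cofibrantObjects M ⊓ lFibrantObjects R

/-- The category `M_cof^{f,L}`. -/
abbrev CofibrantLFibrantObject (R : MorphismProperty M) : Type u :=
  (cofibrantLFibrantObjects R).FullSubcategory

/-- The inclusion functor `M_cof^{f,L} ⥤ M_cof`. -/
abbrev inclusion (R : MorphismProperty M) : CofibrantLFibrantObject R ⥤ CofibrantObject M :=
  ObjectProperty.ιOfLE inf_le_left

variable {L R : MorphismProperty M} (φ : MorphismProperty.FunctorialFactorizationData L R)

/-- The fibrant replacement functor `R_L : M_cof ⥤ M_cof^{f,L}`. -/
noncomputable def functorR (hL : L ≤ cofibrations M) :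
    CofibrantObject M ⥤ CofibrantLFibrantObject R :=
  (cofibrantLFibrantObjects R).lift (CofibrantObject.ι ⋙ fibrantReplacement φ) (fun X => by
    refine ⟨?_, lFibrantObjects_fibrantReplacement φ X.obj⟩
    have h : Cofibration (φ.factorizationData (terminal.from X.obj)).i :=
      (cofibration_iff _).2 (hL _ (φ.factorizationData (terminal.from X.obj)).hi)
    have hX : IsCofibrant X.obj := X.property
    exact isCofibrant_of_cofibration (hX := hX)
      (Y := (φ.factorizationData (terminal.from X.obj)).Z)
      (φ.factorizationData (terminal.from X.obj)).i)

/-- The category `M_cof^{f,L}/∼_L`. -/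
abbrev HomotopyQuotient : Type u := Quotient (HomotopicOn φ (cofibrantLFibrantObjects R))

/-- The canonical functor `M_cof^{f,L} ⥤ M_cof^{f,L}/∼_L`. -/
abbrev quotientFunctor : CofibrantLFibrantObject R ⥤ HomotopyQuotient φ := Quotient.functor _

/-- The morphisms of `M_cof` which belong to `W ∪ L`. -/
def cofWL (L : MorphismProperty M) : MorphismProperty (CofibrantObject M) :=
  (weakEquivalences M ⊔ L).inverseImage CofibrantObject.ι

/-- The class `W_L` of morphisms `f : X ⟶ Y` of `M` such that, for every `Z` in `M_cof^{f,L}`,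
the map `M(R_L(Q(Y)), Z)/∼_L → M(R_L(Q(X)), Z)/∼_L` induced by `f` is bijective. -/
def classWL (ψ : MorphismProperty.FunctorialFactorizationData
    (cofibrations M) (trivialFibrations M)) : MorphismProperty M := fun _ _ f =>
  ∀ Z : M, cofibrantLFibrantObjects R Z → Function.Bijective
    (HomotopyClasses.precomp φ ((fibrantReplacement φ).map ((cofibrantReplacement ψ).map f)) Z)

end ModelCategories

end WFSLocalization

open WFSLocalization

namespace WFSLocalization

/-! ### Homotopy classes of maps into objects that are fibrant with respect to `L`. -/

section HomotopyClasses

/-! This is Whitehead's theorem relative to `L`. A morphism `w` in `L` induces bijections on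
`∼_L`-classes of maps into any object fibrant with respect to `L`: maps extend along `w` by lifting
against `Z ⟶ 1`, and homotopies extend by lifting against the path object projection
(`HomotopyClasses.bijective_precomp`). Trivial cofibrations lie in `L`, so Ken Brown's factorization
gives the same bijections, for these targets, for weak equivalences between cofibrant objects. By
the Yoneda lemma, a morphism of `M_cof^{f,L}` inducing such bijections for all targets in that
category is invertible modulo `∼_L`; hence `R_L` sends `W ∪ L` to isomorphisms of the quotient.

Conversely, localizing at `W ∪ L` identifies homotopic maps: for cofibrant `Y` the path object is
cofibrant, and its two projections to `Y` share the section `Y ⟶ Path_L(Y)`, which lies in `L`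
(`cofWL_Q_map_eq_of_rightHomotopic`).

The inclusions and `R_L`, `Q` thus descend to quotients and localizations. They become mutually
inverse there because `X ⟶ R_L(X)` lies in `L` and `Q(X) ⟶ X` in `W`. The factorization through
`Ho(M)` amounts to `W ⊆ W_L`. -/

lemma exists_extension {M : Type u} [Category.{v} M] [HasTerminal M] {L R : MorphismProperty M}
    [MorphismProperty.IsWeakFactorizationSystem L R] {X Y Z : M} {w : X ⟶ Y}
    (hw : L w) (hZ : lFibrantObjects R Z) (f : X ⟶ Z) : ∃ g : Y ⟶ Z, w ≫ g = f := by
  have : HasLiftingProperty w (terminal.from Z) :=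
    MorphismProperty.hasLiftingProperty_of_wfs (W₁ := L) (W₂ := R) _ _ hw hZ
  have sq : CommSq f w (terminal.from Z) (terminal.from Y) := ⟨Subsingleton.elim _ _⟩
  exact ⟨sq.lift, sq.fac_left⟩

variable {M : Type u} [Category.{v} M] {L R : MorphismProperty M}
  (φ : MorphismProperty.FunctorialFactorizationData L R) [HasBinaryProducts M]

lemma HomotopyClasses.precomp_comp {X Y T : M} (f : X ⟶ Y) (g : Y ⟶ T) (Z : M) :
    HomotopyClasses.precomp φ (f ≫ g) Z =
      HomotopyClasses.precomp φ f Z ∘ HomotopyClasses.precomp φ g Z := by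
  funext k
  induction k using Quot.ind with
  | mk k => exact congrArg (Quot.mk _) (Category.assoc f g k)

lemma HomotopyClasses.precomp_id (X Z : M) :
    HomotopyClasses.precomp φ (𝟙 X) Z = id := by
  funext k
  induction k using Quot.ind with
  | mk k => exact congrArg (Quot.mk _) (Category.id_comp k)

variable [MorphismProperty.IsWeakFactorizationSystem L R]

lemma HomotopyClasses.mk_eq_iff {X Z : M} (f g : X ⟶ Z) :
    (Quot.mk _ f : HomotopyClasses φ X Z) = Quot.mk _ g ↔ Homotopic φ f g :=
  Equivalence.quot_mk_eq_iff (congruence_homotopic φ).equivalence f g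

lemma RightHomotopic.of_precomp {X Y Z : M} {w : X ⟶ Y} (hw : L w) {f g : Y ⟶ Z}
    (h : RightHomotopic φ (w ≫ f) (w ≫ g)) : RightHomotopic φ f g := by
  obtain ⟨H, hH⟩ := h
  have : HasLiftingProperty w (pathObjπ φ Z) :=
    MorphismProperty.hasLiftingProperty_of_wfs (W₁ := L) (W₂ := R) _ _ hw
      (φ.factorizationData (diag Z)).hp
  have sq : CommSq H w (pathObjπ φ Z) (prod.lift f g) := ⟨by rw [hH, prod.comp_lift]⟩
  exact ⟨sq.lift, sq.fac_right⟩

/-- A single homotopy lifts by `RightHomotopic.of_precomp`; fibrancy of `Z` is what allows a chain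
of them to be lifted. -/
lemma Homotopic.of_precomp [HasTerminal M] {X Y Z : M} {w : X ⟶ Y} (hw : L w)
    (hZ : lFibrantObjects R Z) {f g : Y ⟶ Z}
    (h : Homotopic φ (w ≫ f) (w ≫ g)) : Homotopic φ f g := by
  -- The endpoints are generalized because the intermediate maps of a chain `X ⟶ Z` need not be
  -- given as composites with `w`.
  suffices ∀ a b : X ⟶ Z, Homotopic φ a b → ∀ f g : Y ⟶ Z, w ≫ f = a → w ≫ g = b →
      Homotopic φ f g from this _ _ h _ _ rfl rfl
  intro a b hab
  induction hab with
  | single h =>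
    rintro f g rfl rfl
    exact .single (.of_precomp φ hw h)
  | @tail b c _ h ih =>
    rintro f g hf rfl
    -- The intermediate map is itself extended along `w`, so that the last link of the chain also
    -- lifts.
    obtain ⟨k, rfl⟩ := exists_extension hw hZ b
    exact (ih f k hf rfl).tail (.of_precomp φ hw h)

lemma HomotopyClasses.bijective_precomp [HasTerminal M] {X Y Z : M} {w : X ⟶ Y} (hw : L w)
    (hZ : lFibrantObjects R Z) : Function.Bijective (HomotopyClasses.precomp φ w Z) := by
  constructor
  · intro a b
    induction a using Quot.ind with | mk a
    induction b using Quot.ind with | mk b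
    intro h
    exact (mk_eq_iff φ a b).2 (.of_precomp φ hw hZ ((mk_eq_iff φ _ _).1 h))
  · intro a
    induction a using Quot.ind with | mk a
    obtain ⟨b, rfl⟩ := exists_extension hw hZ a
    exact ⟨Quot.mk _ b, rfl⟩

end HomotopyClasses

/-! ### Natural transformations of the two replacements. -/

section Replacements

/-- The natural transformation from the identity to the fibrant replacement. -/
noncomputable def fibrantReplacementι {M : Type u} [Category.{v} M] [HasTerminal M]
    {L R : MorphismProperty M} (φ : MorphismProperty.FunctorialFactorizationData L R) :
    𝟭 M ⟶ fibrantReplacement φ where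
  app X := (φ.factorizationData (terminal.from X)).i
  naturality X Y f := (φ.i_mapZ (Arrow.homMk f (𝟙 _) (by simp) :
    Arrow.mk (terminal.from X) ⟶ Arrow.mk (terminal.from Y))).symm

lemma fibrantReplacementι_mem {M : Type u} [Category.{v} M] [HasTerminal M]
    {L R : MorphismProperty M} (φ : MorphismProperty.FunctorialFactorizationData L R) (X : M) :
    L ((fibrantReplacementι φ).app X) :=
  (φ.factorizationData (terminal.from X)).hi

variable {M : Type u} [Category.{v} M] [ModelCategory M]
  (ψ : MorphismProperty.FunctorialFactorizationData (cofibrations M) (trivialFibrations M))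

/-- The natural transformation from the cofibrant replacement to the identity. -/
noncomputable def cofibrantReplacementπ : cofibrantReplacement ψ ⟶ 𝟭 M where
  app X := (ψ.factorizationData (initial.to X)).p
  naturality X Y f := ψ.mapZ_p (Arrow.homMk (𝟙 _) f (by simp) :
    Arrow.mk (initial.to X) ⟶ Arrow.mk (initial.to Y))

instance (X : M) : WeakEquivalence ((cofibrantReplacementπ ψ).app X) :=
  (weakEquivalence_iff _).2 (ψ.factorizationData (initial.to X)).hp.2

instance (X : M) : IsCofibrant ((cofibrantReplacement ψ).obj X) :=
  ((functorQ ψ).obj X).property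

lemma weakEquivalence_cofibrantReplacement_map {X Y : M} (f : X ⟶ Y) [WeakEquivalence f] :
    WeakEquivalence ((cofibrantReplacement ψ).map f) := by
  have : WeakEquivalence ((cofibrantReplacementπ ψ).app X ≫ (𝟭 M).map f) :=
    (inferInstance : WeakEquivalence ((cofibrantReplacementπ ψ).app X ≫ f))
  exact weakEquivalence_of_postcomp_of_fac ((cofibrantReplacementπ ψ).naturality f)

end Replacements

/-! ### Local equivalences and the Whitehead theorem. -/

section LocalEquivalences

variable {M : Type u} [Category.{v} M] [ModelCategory M] {L R : MorphismProperty M}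
  (φ : MorphismProperty.FunctorialFactorizationData L R)

/-- The morphisms `f : X ⟶ Y` which induce bijections `M(Y, Z)/∼_L → M(X, Z)/∼_L` for all
cofibrant `Z` which are fibrant with respect to `L`. -/
def localEquivalences : MorphismProperty M := fun _ _ f =>
  ∀ Z : M, cofibrantLFibrantObjects R Z → Function.Bijective (HomotopyClasses.precomp φ f Z)

instance : (localEquivalences φ).HasTwoOutOfThreeProperty where
  comp_mem f g hf hg Z hZ := by
    rw [HomotopyClasses.precomp_comp]
    exact (hf Z hZ).comp (hg Z hZ)
  of_postcomp f g hg hfg Z hZ := by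
    have h := hfg Z hZ
    rw [HomotopyClasses.precomp_comp] at h
    exact (Function.Bijective.of_comp_iff _ (hg Z hZ)).1 h
  of_precomp f g hf hfg Z hZ := by
    have h := hfg Z hZ
    rw [HomotopyClasses.precomp_comp] at h
    exact (Function.Bijective.of_comp_iff' (hf Z hZ) _).1 h

lemma id_mem_localEquivalences (X : M) : localEquivalences φ (𝟙 X) := fun Z _ => by
  rw [HomotopyClasses.precomp_id]
  exact Function.bijective_id

variable [MorphismProperty.IsWeakFactorizationSystem L R]

lemma le_localEquivalences : L ≤ localEquivalences φ := fun _ _ _ hf _ hZ =>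
  HomotopyClasses.bijective_precomp φ hf hZ.2

/-- Ken Brown's argument: `f = i ≫ p`, where `i` is a trivial cofibration and `p` is a retraction of
a trivial cofibration `s`. Both `i` and `s` lie in `L`, and two-out-of-three handles `p`. -/
lemma localEquivalences_of_weakEquivalence (hL : trivialCofibrations M ≤ L)
    {X Y : M} [IsCofibrant X] [IsCofibrant Y] (f : X ⟶ Y) [WeakEquivalence f] :
    localEquivalences φ f := by
  obtain ⟨h⟩ : Nonempty (CofibrantBrownFactorization f) := inferInstance
  have : Cofibration h.i := (cofibration_iff _).2 h.hi
  have hi : localEquivalences φ h.i :=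
    le_localEquivalences φ _ (hL _ (mem_trivialCofibrations h.i))
  have hs : localEquivalences φ h.s :=
    le_localEquivalences φ _ (hL _ (mem_trivialCofibrations h.s))
  have hp : localEquivalences φ h.p := by
    refine (localEquivalences φ).of_precomp _ _ hs ?_
    rw [h.s_p]
    exact id_mem_localEquivalences φ Y
  rw [← h.fac]
  exact (localEquivalences φ).comp_mem _ _ hi hp

lemma localEquivalences_of_cofWL (hL : trivialCofibrations M ≤ L) {X Y : CofibrantObject M}
    (f : X ⟶ Y) (hf : cofWL L f) : localEquivalences φ f.hom := by
  obtain hf | hf := hf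
  · have : WeakEquivalence f.hom := (weakEquivalence_iff _).2 hf
    exact localEquivalences_of_weakEquivalence φ hL f.hom
  · exact le_localEquivalences φ _ hf

/-- Two-out-of-three in the naturality square of `X ⟶ R_L(X)`, whose components lie in `L`. -/
lemma localEquivalences_fibrantReplacement_map_iff {X Y : M} (f : X ⟶ Y) :
    localEquivalences φ ((fibrantReplacement φ).map f) ↔ localEquivalences φ f := by
  have hX := le_localEquivalences φ _ (fibrantReplacementι_mem φ X)
  have hY := le_localEquivalences φ _ (fibrantReplacementι_mem φ Y)
  have e := (fibrantReplacementι φ).naturality f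
  dsimp at e
  rw [← (localEquivalences φ).precomp_iff _ _ hX, ← e, (localEquivalences φ).postcomp_iff _ _ hY]

/-- The Yoneda lemma in the homotopy quotient. -/
lemma isIso_quotientFunctor_map {X Y : CofibrantLFibrantObject R} (f : X ⟶ Y)
    (hf : localEquivalences φ f.hom) : IsIso ((quotientFunctor φ).map f) := by
  -- Surjectivity with target `X`, applied to the identity class, yields a one-sided homotopy
  -- inverse.
  obtain ⟨g, hg⟩ := (hf X.obj X.property).2 (Quot.mk _ (𝟙 X.obj))
  induction g using Quot.ind with | mk g
  have hg : Homotopic φ (f.hom ≫ g) (𝟙 X.obj) := (HomotopyClasses.mk_eq_iff φ _ _).1 hg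
  have hg' : Homotopic φ (g ≫ f.hom) (𝟙 Y.obj) := by
    -- Injectivity with target `Y` makes it two-sided, since `f ≫ g ≫ f` and `f` are homotopic.
    refine (HomotopyClasses.mk_eq_iff φ _ _).1 ((hf Y.obj Y.property).1 ?_)
    refine (HomotopyClasses.mk_eq_iff φ _ _).2 ?_
    have := hg.postcomp φ f.hom
    simpa using this
  refine ⟨(quotientFunctor φ).map (ObjectProperty.homMk g), ?_, ?_⟩
  · rw [← Functor.map_comp]
    exact (CategoryTheory.Quotient.sound (HomotopicOn φ (cofibrantLFibrantObjects R)) hg).trans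
      ((quotientFunctor φ).map_id X)
  · rw [← Functor.map_comp]
    exact (CategoryTheory.Quotient.sound (HomotopicOn φ (cofibrantLFibrantObjects R)) hg').trans
      ((quotientFunctor φ).map_id Y)

end LocalEquivalences

/-! ### Induced functors and the two equivalences of categories. -/

section Functors

variable {M : Type u} [Category.{v} M] [ModelCategory M] {L R : MorphismProperty M}
  (φ : MorphismProperty.FunctorialFactorizationData L R)
  (ψ : MorphismProperty.FunctorialFactorizationData (cofibrations M) (trivialFibrations M))

/-- The natural transformation `X ⟶ R_L(X)` in `M_cof`. -/
noncomputable def functorRι (hL : L ≤ cofibrations M) :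
    𝟭 (CofibrantObject M) ⟶ functorR φ hL ⋙ inclusion R where
  app X := ObjectProperty.homMk ((fibrantReplacementι φ).app X.obj)
  naturality X Y f := by
    ext
    exact (fibrantReplacementι φ).naturality f.hom

lemma functorRι_mem (hL : L ≤ cofibrations M) (X : CofibrantObject M) :
    cofWL L ((functorRι φ hL).app X) :=
  Or.inr (fibrantReplacementι_mem φ X.obj)

/-- The natural transformation `X ⟶ R_L(X)` in `M_cof^{f,L}`. -/
noncomputable def inclusionFunctorRι (hL : L ≤ cofibrations M) :
    𝟭 (CofibrantLFibrantObject R) ⟶ inclusion R ⋙ functorR φ hL where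
  app X := ObjectProperty.homMk ((fibrantReplacementι φ).app X.obj)
  naturality X Y f := by
    ext
    exact (fibrantReplacementι φ).naturality f.hom

/-- The natural transformation `Q(X) ⟶ X` in `M`. -/
noncomputable def functorQπ : functorQ ψ ⋙ CofibrantObject.ι ⟶ 𝟭 M where
  app X := (cofibrantReplacementπ ψ).app X
  naturality _ _ f := (cofibrantReplacementπ ψ).naturality f

/-- The natural transformation `Q(X) ⟶ X` in `M_cof`. -/
noncomputable def ιFunctorQπ : CofibrantObject.ι ⋙ functorQ ψ ⟶ 𝟭 (CofibrantObject M) where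
  app X := ObjectProperty.homMk ((cofibrantReplacementπ ψ).app X.obj)
  naturality X Y f := by
    ext
    exact (cofibrantReplacementπ ψ).naturality f.hom

lemma ιFunctorQπ_mem (X : CofibrantObject M) : cofWL L ((ιFunctorQπ ψ).app X) :=
  Or.inl ((weakEquivalence_iff _).1
    (inferInstance : WeakEquivalence ((cofibrantReplacementπ ψ).app X.obj)))

/-- The two projections of the path object agree after localization, as both are inverse to the same
inverted morphism. The assumption `L ≤ cofibrations M` keeps the path object inside `M_cof`. -/
lemma cofWL_Q_map_eq_of_rightHomotopic (hL : L ≤ cofibrations M)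
    {X Y : CofibrantObject M} {f g : X ⟶ Y} (h : RightHomotopic φ f.hom g.hom) :
    (cofWL L).Q.map f = (cofWL L).Q.map g := by
  obtain ⟨H, hH⟩ := h
  have hι : L (pathObjι φ Y.obj) := (φ.factorizationData (diag Y.obj)).hi
  have fac : pathObjι φ Y.obj ≫ pathObjπ φ Y.obj = diag Y.obj :=
    (φ.factorizationData (diag Y.obj)).fac
  have : Cofibration (pathObjι φ Y.obj) := (cofibration_iff _).2 (hL _ hι)
  have : IsCofibrant (pathObj φ Y.obj) := isCofibrant_of_cofibration (pathObjι φ Y.obj)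
  let P : CofibrantObject M := .mk (pathObj φ Y.obj)
  let s : Y ⟶ P := ObjectProperty.homMk (pathObjι φ Y.obj)
  let p₀ : P ⟶ Y := ObjectProperty.homMk (pathObjπ φ Y.obj ≫ prod.fst)
  let p₁ : P ⟶ Y := ObjectProperty.homMk (pathObjπ φ Y.obj ≫ prod.snd)
  let K : X ⟶ P := ObjectProperty.homMk H
  have hs : IsIso ((cofWL L).Q.map s) := (cofWL L).Q_inverts s (Or.inr hι)
  have e₀ : s ≫ p₀ = 𝟙 Y := by
    ext
    change pathObjι φ Y.obj ≫ pathObjπ φ Y.obj ≫ prod.fst = 𝟙 _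
    rw [← Category.assoc, fac, prod.lift_fst]
  have e₁ : s ≫ p₁ = 𝟙 Y := by
    ext
    change pathObjι φ Y.obj ≫ pathObjπ φ Y.obj ≫ prod.snd = 𝟙 _
    rw [← Category.assoc, fac, prod.lift_snd]
  have hp : (cofWL L).Q.map p₀ = (cofWL L).Q.map p₁ := by
    rw [← cancel_epi ((cofWL L).Q.map s), ← Functor.map_comp, ← Functor.map_comp, e₀, e₁]
  have hf : f = K ≫ p₀ := by
    ext
    change f.hom = H ≫ pathObjπ φ Y.obj ≫ prod.fst
    rw [← Category.assoc, hH, prod.lift_fst]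
  have hg : g = K ≫ p₁ := by
    ext
    change g.hom = H ≫ pathObjπ φ Y.obj ≫ prod.snd
    rw [← Category.assoc, hH, prod.lift_snd]
  rw [hf, hg, Functor.map_comp, Functor.map_comp, hp]

lemma cofWL_Q_map_eq_of_homotopic (hL : L ≤ cofibrations M)
    {X Y : CofibrantObject M} {f g : X ⟶ Y} (h : Homotopic φ f.hom g.hom) :
    (cofWL L).Q.map f = (cofWL L).Q.map g := by
  suffices ∀ k : X.obj ⟶ Y.obj, Homotopic φ f.hom k →
      (cofWL L).Q.map f = (cofWL L).Q.map (ObjectProperty.homMk k) from this _ h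
  intro k hk
  induction hk with
  | single h => exact cofWL_Q_map_eq_of_rightHomotopic φ hL h
  | tail _ h ih => exact ih.trans (cofWL_Q_map_eq_of_rightHomotopic φ hL h)

/-- The functor `M_cof^{f,L}/∼_L ⥤ M_cof[(W ∪ L)⁻¹]` induced by the inclusion. -/
noncomputable def quotientToCofLocalization (hL : L ≤ cofibrations M) :
    HomotopyQuotient φ ⥤ (cofWL L).Localization :=
  CategoryTheory.Quotient.lift _ (inclusion R ⋙ (cofWL L).Q)
    (fun _ _ _ _ h => cofWL_Q_map_eq_of_homotopic φ hL h)

lemma quotientFunctor_comp_quotientToCofLocalization (hL : L ≤ cofibrations M) :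
    quotientFunctor φ ⋙ quotientToCofLocalization φ hL = inclusion R ⋙ (cofWL L).Q :=
  CategoryTheory.Quotient.lift_spec _ _ _

variable [MorphismProperty.IsWeakFactorizationSystem L R]

lemma cofWL_isInvertedBy (hL₁ : trivialCofibrations M ≤ L) (hL₂ : L ≤ cofibrations M) :
    (cofWL L).IsInvertedBy (functorR φ hL₂ ⋙ quotientFunctor φ) := fun _ _ f hf =>
  isIso_quotientFunctor_map φ _ ((localEquivalences_fibrantReplacement_map_iff φ f.hom).2
    (localEquivalences_of_cofWL φ hL₁ f hf))

/-- The functor `M_cof[(W ∪ L)⁻¹] ⥤ M_cof^{f,L}/∼_L` induced by `R_L`. -/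
noncomputable def cofLocalizationToQuotient
    (hL₁ : trivialCofibrations M ≤ L) (hL₂ : L ≤ cofibrations M) :
    (cofWL L).Localization ⥤ HomotopyQuotient φ :=
  Localization.Construction.lift _ (cofWL_isInvertedBy φ hL₁ hL₂)

lemma cofWL_Q_comp_cofLocalizationToQuotient
    (hL₁ : trivialCofibrations M ≤ L) (hL₂ : L ≤ cofibrations M) :
    (cofWL L).Q ⋙ cofLocalizationToQuotient φ hL₁ hL₂ = functorR φ hL₂ ⋙ quotientFunctor φ :=
  Localization.Construction.fac _ _

/-- The equivalence `M_cof^{f,L}/∼_L ≌ M_cof[(W ∪ L)⁻¹]`. -/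
noncomputable def quotientEquivalence
    (hL₁ : trivialCofibrations M ≤ L) (hL₂ : L ≤ cofibrations M) :
    HomotopyQuotient φ ≌ (cofWL L).Localization := by
  -- On objects already fibrant with respect to `L`, `X ⟶ R_L(X)` is a local equivalence within
  -- `M_cof^{f,L}`, hence invertible modulo `∼_L`.
  have (X : CofibrantLFibrantObject R) : IsIso ((Functor.whiskerRight (inclusionFunctorRι φ hL₂)
      (quotientFunctor φ)).app X) :=
    isIso_quotientFunctor_map φ _ (le_localEquivalences φ _ (fibrantReplacementι_mem φ X.obj))
  have := NatIso.isIso_of_isIso_app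
    (Functor.whiskerRight (inclusionFunctorRι φ hL₂) (quotientFunctor φ))
  have (X : CofibrantObject M) : IsIso ((Functor.whiskerRight (functorRι φ hL₂)
      (cofWL L).Q).app X) := (cofWL L).Q_inverts _ (functorRι_mem φ hL₂ X)
  have := NatIso.isIso_of_isIso_app (Functor.whiskerRight (functorRι φ hL₂) (cofWL L).Q)
  -- The composites are strictly equal after restriction along the canonical functors; the unit and
  -- counit then descend by the universal properties.
  have e₁ : quotientFunctor φ ⋙ (quotientToCofLocalization φ hL₂ ⋙
      cofLocalizationToQuotient φ hL₁ hL₂) =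
        (inclusion R ⋙ functorR φ hL₂) ⋙ quotientFunctor φ := by
    rw [← Functor.assoc, quotientFunctor_comp_quotientToCofLocalization, Functor.assoc,
      cofWL_Q_comp_cofLocalizationToQuotient, Functor.assoc]
  have e₂ : (cofWL L).Q ⋙ (cofLocalizationToQuotient φ hL₁ hL₂ ⋙
      quotientToCofLocalization φ hL₂) = (functorR φ hL₂ ⋙ inclusion R) ⋙ (cofWL L).Q := by
    rw [← Functor.assoc, cofWL_Q_comp_cofLocalizationToQuotient, Functor.assoc,
      quotientFunctor_comp_quotientToCofLocalization, Functor.assoc]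
  exact CategoryTheory.Equivalence.mk (quotientToCofLocalization φ hL₂)
    (cofLocalizationToQuotient φ hL₁ hL₂)
    (CategoryTheory.Quotient.natIsoLift _ (asIso (Functor.whiskerRight (inclusionFunctorRι φ hL₂)
      (quotientFunctor φ)) ≪≫ eqToIso e₁.symm))
    (letI : Localization.Lifting (cofWL L).Q (cofWL L)
        ((functorR φ hL₂ ⋙ inclusion R) ⋙ (cofWL L).Q) (cofLocalizationToQuotient φ hL₁ hL₂ ⋙
      quotientToCofLocalization φ hL₂) := ⟨eqToIso e₂⟩
     letI : Localization.Lifting (cofWL L).Q (cofWL L) (𝟭 _ ⋙ (cofWL L).Q) (𝟭 _) := ⟨Iso.refl _⟩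
     Localization.liftNatIso (cofWL L).Q (cofWL L) _ _ _ _
      (asIso (Functor.whiskerRight (functorRι φ hL₂) (cofWL L).Q)).symm)

lemma weakEquivalences_le_classWL (hL : trivialCofibrations M ≤ L) :
    weakEquivalences M ≤ classWL φ ψ := fun _ _ f hf => by
  have : WeakEquivalence f := (weakEquivalence_iff _).2 hf
  have := weakEquivalence_cofibrantReplacement_map ψ f
  exact (localEquivalences_fibrantReplacement_map_iff φ _).2
    (localEquivalences_of_weakEquivalence φ hL _)

/-- On cofibrant objects `Q(X) ⟶ X` is a weak equivalence between cofibrant objects, so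
two-out-of-three reduces `Q(f)` to `f`. -/
lemma cofWL_le_classWL_inverseImage (hL : trivialCofibrations M ≤ L) :
    cofWL L ≤ (classWL φ ψ).inverseImage CofibrantObject.ι := fun X Y f hf => by
  refine (localEquivalences_fibrantReplacement_map_iff φ _).2 ?_
  have hX := localEquivalences_of_weakEquivalence φ hL (Y := X.obj)
    ((cofibrantReplacementπ ψ).app X.obj)
  have hY := localEquivalences_of_weakEquivalence φ hL (Y := Y.obj)
    ((cofibrantReplacementπ ψ).app Y.obj)
  have e := (cofibrantReplacementπ ψ).naturality f.hom
  refine (localEquivalences φ).of_postcomp _ _ hY ?_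
  change localEquivalences φ
    ((cofibrantReplacement ψ).map f.hom ≫ (cofibrantReplacementπ ψ).app Y.obj)
  rw [e]
  exact (localEquivalences φ).comp_mem _ _ hX (localEquivalences_of_cofWL φ hL f hf)

/-- The functor `M_cof[(W ∪ L)⁻¹] ⥤ M[W_L⁻¹]` induced by the inclusion. -/
noncomputable def cofLocalizationToLocalization (hL : trivialCofibrations M ≤ L) :
    (cofWL L).Localization ⥤ (classWL φ ψ).Localization :=
  Localization.Construction.lift (CofibrantObject.ι ⋙ (classWL φ ψ).Q) (fun _ _ f hf =>
    (classWL φ ψ).Q_inverts _ (cofWL_le_classWL_inverseImage φ ψ hL f hf))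

lemma cofWL_Q_comp_cofLocalizationToLocalization (hL : trivialCofibrations M ≤ L) :
    (cofWL L).Q ⋙ cofLocalizationToLocalization φ ψ hL =
      CofibrantObject.ι ⋙ (classWL φ ψ).Q :=
  Localization.Construction.fac _ _

/-- Membership in `W_L` says that `R_L(Q(f))` is a local equivalence, hence invertible modulo `∼_L`
and so in `M_cof[(W ∪ L)⁻¹]`. The naturality square of `X ⟶ R_L(X)` transfers this to `Q(f)`. -/
lemma classWL_isInvertedBy (hL₂ : L ≤ cofibrations M) :
    (classWL φ ψ).IsInvertedBy (functorQ ψ ⋙ (cofWL L).Q) := fun X Y f hf => by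
  have h₁ : IsIso ((quotientFunctor φ).map ((functorR φ hL₂).map ((functorQ ψ).map f))) :=
    isIso_quotientFunctor_map φ _ hf
  have h₂ : IsIso ((inclusion R ⋙ (cofWL L).Q).map
      ((functorR φ hL₂).map ((functorQ ψ).map f))) := by
    rw [← quotientFunctor_comp_quotientToCofLocalization φ hL₂, Functor.comp_map]
    infer_instance
  have hX := (cofWL L).Q_inverts _ (functorRι_mem φ hL₂ ((functorQ ψ).obj X))
  have hY := (cofWL L).Q_inverts _ (functorRι_mem φ hL₂ ((functorQ ψ).obj Y))
  have e := congrArg (cofWL L).Q.map ((functorRι φ hL₂).naturality ((functorQ ψ).map f))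
  rw [Functor.map_comp, Functor.map_comp] at e
  have h₃ : IsIso ((cofWL L).Q.map ((functorRι φ hL₂).app ((functorQ ψ).obj X)) ≫
      (cofWL L).Q.map ((functorR φ hL₂ ⋙ inclusion R).map ((functorQ ψ).map f))) :=
    IsIso.comp_isIso' hX h₂
  exact IsIso.of_isIso_fac_right (hh := h₃) e

/-- The functor `M[W_L⁻¹] ⥤ M_cof[(W ∪ L)⁻¹]` induced by the cofibrant replacement. -/
noncomputable def localizationToCofLocalization (hL₂ : L ≤ cofibrations M) :
    (classWL φ ψ).Localization ⥤ (cofWL L).Localization :=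
  Localization.Construction.lift _ (classWL_isInvertedBy φ ψ hL₂)

lemma classWL_Q_comp_localizationToCofLocalization (hL₂ : L ≤ cofibrations M) :
    (classWL φ ψ).Q ⋙ localizationToCofLocalization φ ψ hL₂ = functorQ ψ ⋙ (cofWL L).Q :=
  Localization.Construction.fac _ _

/-- The equivalence `M_cof[(W ∪ L)⁻¹] ≌ M[W_L⁻¹]`. -/
noncomputable def cofLocalizationEquivalence
    (hL₁ : trivialCofibrations M ≤ L) (hL₂ : L ≤ cofibrations M) :
    (cofWL L).Localization ≌ (classWL φ ψ).Localization := by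
  have (X : CofibrantObject M) : IsIso ((Functor.whiskerRight (ιFunctorQπ ψ)
      (cofWL L).Q).app X) := (cofWL L).Q_inverts _ (ιFunctorQπ_mem ψ X)
  have := NatIso.isIso_of_isIso_app (Functor.whiskerRight (ιFunctorQπ ψ) (cofWL L).Q)
  have (X : M) : IsIso ((Functor.whiskerRight (functorQπ ψ) (classWL φ ψ).Q).app X) :=
    (classWL φ ψ).Q_inverts _ (weakEquivalences_le_classWL φ ψ hL₁ _
      ((weakEquivalence_iff _).1
        (inferInstance : WeakEquivalence ((cofibrantReplacementπ ψ).app X))))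
  have := NatIso.isIso_of_isIso_app (Functor.whiskerRight (functorQπ ψ) (classWL φ ψ).Q)
  have e₁ : (cofWL L).Q ⋙ (cofLocalizationToLocalization φ ψ hL₁ ⋙
      localizationToCofLocalization φ ψ hL₂) =
        (CofibrantObject.ι ⋙ functorQ ψ) ⋙ (cofWL L).Q := by
    rw [← Functor.assoc, cofWL_Q_comp_cofLocalizationToLocalization, Functor.assoc,
      classWL_Q_comp_localizationToCofLocalization, Functor.assoc]
  have e₂ : (classWL φ ψ).Q ⋙ (localizationToCofLocalization φ ψ hL₂ ⋙
      cofLocalizationToLocalization φ ψ hL₁) =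
        (functorQ ψ ⋙ CofibrantObject.ι) ⋙ (classWL φ ψ).Q := by
    rw [← Functor.assoc, classWL_Q_comp_localizationToCofLocalization, Functor.assoc,
      cofWL_Q_comp_cofLocalizationToLocalization, Functor.assoc]
  exact CategoryTheory.Equivalence.mk (cofLocalizationToLocalization φ ψ hL₁)
    (localizationToCofLocalization φ ψ hL₂)
    (letI : Localization.Lifting (cofWL L).Q (cofWL L)
        ((CofibrantObject.ι ⋙ functorQ ψ) ⋙ (cofWL L).Q) (cofLocalizationToLocalization φ ψ hL₁ ⋙
          localizationToCofLocalization φ ψ hL₂) := ⟨eqToIso e₁⟩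
     letI : Localization.Lifting (cofWL L).Q (cofWL L) (𝟭 _ ⋙ (cofWL L).Q) (𝟭 _) := ⟨Iso.refl _⟩
     Localization.liftNatIso (cofWL L).Q (cofWL L) _ _ _ _
      (asIso (Functor.whiskerRight (ιFunctorQπ ψ) (cofWL L).Q)).symm)
    (letI : Localization.Lifting (classWL φ ψ).Q (classWL φ ψ)
        ((functorQ ψ ⋙ CofibrantObject.ι) ⋙ (classWL φ ψ).Q)
        (localizationToCofLocalization φ ψ hL₂ ⋙
          cofLocalizationToLocalization φ ψ hL₁) := ⟨eqToIso e₂⟩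
     letI : Localization.Lifting (classWL φ ψ).Q (classWL φ ψ) (𝟭 _ ⋙ (classWL φ ψ).Q) (𝟭 _) :=
      ⟨Iso.refl _⟩
     Localization.liftNatIso (classWL φ ψ).Q (classWL φ ψ) _ _ _ _
      (asIso (Functor.whiskerRight (functorQπ ψ) (classWL φ ψ).Q)))

end Functors

end WFSLocalization

theorem theorem3 {M : Type u} [Category.{v} M] [HasLimits M] [HasColimits M] [ModelCategory M]
    (L R : MorphismProperty M)
    (hJ : IsCofibrantlyGeneratedWFS (trivialCofibrations M) (fibrations M))
    (hLR : IsCofibrantlyGeneratedWFS L R)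
    (hL₁ : trivialCofibrations M ≤ L) (hL₂ : L ≤ cofibrations M)
    -- the fixed functorial factorizations
    (φ : MorphismProperty.FunctorialFactorizationData L R)
    (ψ : MorphismProperty.FunctorialFactorizationData (cofibrations M) (trivialFibrations M)) :
    -- the functors induced by the inclusions are equivalences, as is the one induced by `R_L ∘ Q`
    (∃ (F₁ : HomotopyQuotient φ ⥤ (cofWL L).Localization)
        (F₂ : (cofWL L).Localization ⥤ (classWL φ ψ).Localization)
        (G : (classWL φ ψ).Localization ⥤ HomotopyQuotient φ),
      (quotientFunctor φ ⋙ F₁ = inclusion R ⋙ (cofWL L).Q ∧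
        ∀ F' : HomotopyQuotient φ ⥤ (cofWL L).Localization,
          quotientFunctor φ ⋙ F' = inclusion R ⋙ (cofWL L).Q → F' = F₁) ∧
      ((cofWL L).Q ⋙ F₂ = CofibrantObject.ι ⋙ (classWL φ ψ).Q ∧
        ∀ F' : (cofWL L).Localization ⥤ (classWL φ ψ).Localization,
          (cofWL L).Q ⋙ F' = CofibrantObject.ι ⋙ (classWL φ ψ).Q → F' = F₂) ∧
      ((classWL φ ψ).Q ⋙ G = (functorQ ψ ⋙ functorR φ hL₂) ⋙ quotientFunctor φ ∧
        ∀ G' : (classWL φ ψ).Localization ⥤ HomotopyQuotient φ,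
          (classWL φ ψ).Q ⋙ G' = (functorQ ψ ⋙ functorR φ hL₂) ⋙ quotientFunctor φ → G' = G) ∧
      F₁.IsEquivalence ∧ F₂.IsEquivalence ∧ G.IsEquivalence ∧
      Nonempty ((F₁ ⋙ F₂) ⋙ G ≅ 𝟭 _) ∧ Nonempty (G ⋙ (F₁ ⋙ F₂) ≅ 𝟭 _)) ∧
    -- the localization functor factors uniquely through `Ho(M)`
    (∃! H : (weakEquivalences M).Localization ⥤ (classWL φ ψ).Localization,
      (weakEquivalences M).Q ⋙ H = (classWL φ ψ).Q) := by
  have := hLR.isWeakFactorizationSystem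
  let E := (quotientEquivalence φ hL₁ hL₂).trans (cofLocalizationEquivalence φ ψ hL₁ hL₂)
  have hW := weakEquivalences_le_classWL φ ψ hL₁
  have hG : (classWL φ ψ).Q ⋙ E.inverse =
      (functorQ ψ ⋙ functorR φ hL₂) ⋙ quotientFunctor φ := by
    -- The inverse of the composite equivalence unfolds to the functor induced by `Q` followed by
    -- the one induced by `R_L`.
    change ((classWL φ ψ).Q ⋙ localizationToCofLocalization φ ψ hL₂) ⋙
      cofLocalizationToQuotient φ hL₁ hL₂ = _
    rw [classWL_Q_comp_localizationToCofLocalization, Functor.assoc,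
      cofWL_Q_comp_cofLocalizationToQuotient, Functor.assoc]
  refine ⟨⟨quotientToCofLocalization φ hL₂, cofLocalizationToLocalization φ ψ hL₁, E.inverse,
    ⟨quotientFunctor_comp_quotientToCofLocalization φ hL₂, fun F' h =>
      CategoryTheory.Quotient.lift_unique' _ _ _
        (h.trans (quotientFunctor_comp_quotientToCofLocalization φ hL₂).symm)⟩,
    ⟨cofWL_Q_comp_cofLocalizationToLocalization φ ψ hL₁, fun F' h =>
      Localization.Construction.uniq _ _
        (h.trans (cofWL_Q_comp_cofLocalizationToLocalization φ ψ hL₁).symm)⟩,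
    ⟨hG, fun G' h => Localization.Construction.uniq _ _ (h.trans hG.symm)⟩,
    (quotientEquivalence φ hL₁ hL₂).isEquivalence_functor,
    (cofLocalizationEquivalence φ ψ hL₁ hL₂).isEquivalence_functor,
    E.isEquivalence_inverse, ⟨E.unitIso.symm⟩, ⟨E.counitIso⟩⟩, ?_⟩
  have hQ : (weakEquivalences M).IsInvertedBy (classWL φ ψ).Q := fun _ _ f hf =>
    (classWL φ ψ).Q_inverts f (hW f hf)
  exact ⟨Localization.Construction.lift _ hQ, Localization.Construction.fac _ hQ, fun H h =>
    Localization.Construction.uniq _ _ (h.trans (Localization.Construction.fac _ hQ).symm)⟩
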